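/- Let $k$ be an algebraically closed field, let $N$ be a free abelian group of finite rank, and put $M=\operatorname{Hom}(N,\mathbb Z)$, $N_{\mathbb R}=N\otimes_{\mathbb Z}\mathbb R$, $M_{\mathbb R}=\operatorname{Hom}_{\mathbb R}(N_{\mathbb R},\mathbb R)=M\otimes_{\mathbb Z}\mathbb R$. For a cone $\sigma\subset N_{\mathbb R}$ let $\sigma^*=\{u\in M_{\mathbb R}: u(v)\ge 0 \text{ for all } v\in\sigma\}$; a face of $\sigma$ is a subset of the form $\sigma\cap u^\perp$ with $u\in\sigma^*$. A fan $\Delta$ in $N_{\mathbb R}$ is a nonempty finite collection of strongly convex rational polyhedral cones in $N_{\mathbb R}$ such that every face of a cone in $\Delta$ is in $\Delta$, and the intersection of any two cones in $\Delta$ is a face of both. The toric variety $X(\Delta)$ over $k$ is obtained from the affine varieties $U_\sigma=\operatorname{Spec} k[\sigma^*\cap M]$, $\sigma\in\Delta$, by gluing $U_\sigma$ and $U_\tau$ along their common open subvariety $U_{\sigma\cap\tau}$, for all $\sigma,\tau\in\Delta$. Then $X(\Delta)$ is affine if and only if $\Delta$ is generated by a single cone, that is, there is a cone $\sigma\in\Delta$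 such that $\Delta$ consists of $\sigma$ together with all of its faces. -/

import Mathlib

open CategoryTheory CategoryTheory.Limits AlgebraicGeometry
open scoped TensorProduct

universe u v

noncomputable section

namespace Toric

/-- The real vector space `N_ℝ = N ⊗ ℝ`. -/
abbrev RealSpace (N : Type v) [AddCommGroup N] : Type v := ℝ ⊗[ℤ] N

section Cones

variable {N : Type v} [AddCommGroup N]

/-- The dual cone `σ* = {u ∈ M_ℝ | (u, v) ≥ 0 for all v ∈ σ}`, where `M_ℝ` is the dual space of
`N_ℝ`. -/
def dualCone (σ : PointedCone ℝ (RealSpace N)) :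
    PointedCone ℝ (Module.Dual ℝ (RealSpace N)) :=
  PointedCone.dual (Module.Dual.eval ℝ (RealSpace N)) (σ : Set (RealSpace N))

/-- `τ` is a face of `σ`: `τ = σ ∩ u^⊥` for some `u ∈ σ*`. -/
def IsFace (τ σ : PointedCone ℝ (RealSpace N)) : Prop :=
  ∃ u ∈ dualCone σ, (τ : Set (RealSpace N)) = (σ : Set (RealSpace N)) ∩ {x | u x = 0}

/-- `σ` consists of the nonnegative real combinations of finitely many elements of `N`. -/
def IsRational (σ : PointedCone ℝ (RealSpace N)) : Prop :=
  ∃ s : Finset N, σ = PointedCone.hull ℝ ((fun n : N => (1 : ℝ) ⊗ₜ[ℤ] n) '' (s : Set N))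

/-- `S_σ = σ* ∩ M`, where `M = Hom(N, ℤ)` is mapped to `M_ℝ` by base change. -/
def dualMonoid (σ : PointedCone ℝ (RealSpace N)) : AddSubmonoid (Module.Dual ℤ N) :=
  (dualCone σ).toAddSubmonoid.comap
    (Module.Dual.baseChange ℝ : Module.Dual ℤ N →ₗ[ℤ] Module.Dual ℝ (RealSpace N)).toAddMonoidHom

theorem mem_dualCone {σ : PointedCone ℝ (RealSpace N)} {u : Module.Dual ℝ (RealSpace N)} :
    u ∈ dualCone σ ↔ ∀ x ∈ σ, 0 ≤ u x := Iff.rfl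

theorem mem_dualMonoid {σ : PointedCone ℝ (RealSpace N)} {m : Module.Dual ℤ N} :
    m ∈ dualMonoid σ ↔ ∀ x ∈ σ, 0 ≤ m.baseChange ℝ x := Iff.rfl

theorem dualMonoid_anti {τ σ : PointedCone ℝ (RealSpace N)} (h : τ ≤ σ) :
    dualMonoid σ ≤ dualMonoid τ := fun _ hm _ hx => hm (h hx)

theorem IsFace.le {τ σ : PointedCone ℝ (RealSpace N)} (h : IsFace τ σ) : τ ≤ σ := by
  obtain ⟨u, -, h⟩ := h
  intro x hx
  have : x ∈ (τ : Set (RealSpace N)) := hx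
  rw [h] at this
  exact this.1

/-- nonnegativity on a hull may be tested on generators -/
theorem nonneg_of_hull {s : Set N} (u : Module.Dual ℝ (RealSpace N))
    (hu : ∀ n ∈ s, 0 ≤ u (1 ⊗ₜ n)) {x : RealSpace N}
    (hx : x ∈ PointedCone.hull ℝ ((fun n : N => (1 : ℝ) ⊗ₜ[ℤ] n) '' s)) : 0 ≤ u x := by
  have : u ∈ PointedCone.dual (Module.Dual.eval ℝ (RealSpace N))
      (PointedCone.hull ℝ ((fun n : N => (1 : ℝ) ⊗ₜ[ℤ] n) '' s) : Set (RealSpace N)) := by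
    rw [PointedCone.dual_hull]
    rintro _ ⟨n, hn, rfl⟩
    exact hu n hn
  exact this hx

/-- simultaneous rational approximation: an additive map to the reals can be replaced, on finitely
many elements, by an integral one without changing signs. -/
theorem exists_int_dual [Module.Finite ℤ N] (f : N →ₗ[ℤ] ℝ) (s : Finset N)
    (hf : ∀ n ∈ s, 0 ≤ f n) :
    ∃ m : Module.Dual ℤ N, ∀ n ∈ s, 0 ≤ m n ∧ (m n = 0 ↔ f n = 0) := by
  classical
  let A := LinearMap.range f
  let b := Module.finBasis ℤ A
  let c : Fin (Module.finrank ℤ A) → Module.Dual ℤ N := fun j => b.coord j ∘ₗ f.rangeRestrict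
  have hfc : ∀ n, f n = ∑ j, (c j n : ℝ) * (b j : ℝ) := by
    intro n
    have h := congrArg (Subtype.val) (b.sum_repr (f.rangeRestrict n))
    simp only [AddSubmonoidClass.coe_finsetSum, SetLike.val_smul] at h
    simpa [c, zsmul_eq_mul] using h.symm
  have hc0 : ∀ n, f n = 0 → ∀ j, c j n = 0 := by
    intro n hn j
    have : f.rangeRestrict n = 0 := Subtype.ext hn
    simp [c, this]
  let G : N → (Fin (Module.finrank ℤ A) → ℝ) → ℝ := fun n q => ∑ j, (c j n : ℝ) * q j
  have hG : ∀ n, Continuous (G n) := fun n => by fun_prop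
  have hopen : IsOpen (⋂ n ∈ s.filter (fun n => 0 < f n), {q | 0 < G n q}) :=
    isOpen_biInter_finset fun n _ => isOpen_lt continuous_const (hG n)
  have hdense : DenseRange (fun (q : Fin (Module.finrank ℤ A) → ℚ) j => (q j : ℝ)) :=
    DenseRange.piMap (fun _ => Rat.denseRange_cast)
  obtain ⟨q, hq⟩ := hdense.exists_mem_open hopen ⟨fun j => (b j : ℝ), by
    simp only [Set.mem_iInter, Finset.mem_filter, Set.mem_ofPred_eq]
    intro n hn
    simpa [G, ← hfc] using hn.2⟩
  obtain ⟨d, hd, z, hz⟩ : ∃ d : ℕ, 0 < d ∧ ∃ z : Fin (Module.finrank ℤ A) → ℤ,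
      ∀ j, (z j : ℝ) = d * (q j : ℝ) := by
    refine ⟨∏ j, (q j).den, Finset.prod_pos fun j _ => (q j).den_pos,
      fun j => (q j).num * ∏ i ∈ Finset.univ.erase j, ((q i).den : ℤ), fun j => ?_⟩
    have : ((q j : ℚ) : ℝ) * (q j).den = (q j).num := by exact_mod_cast Rat.mul_den_eq_num (q j)
    rw [← Finset.mul_prod_erase _ _ (Finset.mem_univ j)]
    push_cast
    rw [← this]
    ring
  refine ⟨∑ j, z j • c j, fun n hn => ?_⟩
  have hval : (((∑ j, z j • c j) n : ℤ) : ℝ) = d * G n (fun j => (q j : ℝ)) := by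
    simp only [LinearMap.sum_apply, LinearMap.smul_apply, smul_eq_mul, Int.cast_sum, Int.cast_mul,
      hz, G, Finset.mul_sum]
    exact Finset.sum_congr rfl fun j _ => by ring
  rcases (hf n hn).eq_or_lt with h0 | hpos
  · have : (∑ j, z j • c j) n = 0 := by
      simp [LinearMap.sum_apply, hc0 n h0.symm]
    simp [this, h0.symm]
  · have h1 : 0 < G n (fun j => (q j : ℝ)) := by
      simp only [Set.mem_iInter, Finset.mem_filter, Set.mem_ofPred_eq] at hq
      exact hq n ⟨hn, hpos⟩
    have h2 : (0 : ℝ) < ((∑ j, z j • c j) n : ℤ) := by rw [hval]; positivity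
    have h3 : 0 < (∑ j, z j • c j) n := by exact_mod_cast h2
    exact ⟨h3.le, iff_of_false h3.ne' hpos.ne'⟩

/-- on the hull of a finite set, the zero set of a nonnegative functional is determined by the
generators on which it vanishes -/
theorem eq_zero_of_hull {s : Finset N} (u w : Module.Dual ℝ (RealSpace N))
    (hu : ∀ n ∈ s, 0 ≤ u (1 ⊗ₜ n)) (hw : ∀ n ∈ s, 0 ≤ w (1 ⊗ₜ n))
    (huw : ∀ n ∈ s, u (1 ⊗ₜ n) = 0 → w (1 ⊗ₜ n) = 0) {x : RealSpace N}
    (hx : x ∈ PointedCone.hull ℝ ((fun n : N => (1 : ℝ) ⊗ₜ[ℤ] n) '' (s : Set N)))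
    (hx0 : u x = 0) : w x = 0 := by
  obtain ⟨C, hC⟩ : ∃ C : ℝ, ∀ n ∈ s, 0 ≤ (C • u - w) ((1 : ℝ) ⊗ₜ[ℤ] n) := by
    refine ⟨∑ n ∈ s, w (1 ⊗ₜ n) / u (1 ⊗ₜ n), fun n hn => ?_⟩
    have hnn : ∀ n ∈ s, 0 ≤ w (1 ⊗ₜ n) / u (1 ⊗ₜ n) := fun n hn =>
      div_nonneg (hw n hn) (hu n hn)
    rcases (hu n hn).eq_or_lt with h0 | hpos
    · simp [h0.symm, huw n hn h0.symm]
    · have := Finset.single_le_sum hnn hn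
      rw [div_le_iff₀ hpos] at this
      simpa using this
  have h1 := nonneg_of_hull (s := (s : Set N)) _ hC hx
  have h2 := nonneg_of_hull (s := (s : Set N)) w hw hx
  simp only [LinearMap.sub_apply, LinearMap.smul_apply, hx0, smul_zero, zero_sub] at h1
  linarith

/-- The lattice functional `m` cuts out the face `τ` of `σ`. -/
structure CutsOut (m : Module.Dual ℤ N) (τ σ : PointedCone ℝ (RealSpace N)) : Prop where
  mem : m ∈ dualMonoid σ
  mem_iff : ∀ x, x ∈ τ ↔ x ∈ σ ∧ m.baseChange ℝ x = 0

/-- A face of a rational cone is cut out by a lattice functional. -/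
theorem IsFace.exists_cutsOut [Module.Finite ℤ N] {τ σ : PointedCone ℝ (RealSpace N)}
    (h : IsFace τ σ) (hσ : IsRational σ) : ∃ m, CutsOut m τ σ := by
  obtain ⟨u, hu, hτ⟩ := h
  obtain ⟨s, rfl⟩ := hσ
  have hgen : ∀ n ∈ s, 0 ≤ u ((1 : ℝ) ⊗ₜ[ℤ] n) :=
    fun n hn => hu (Submodule.subset_span ⟨n, hn, rfl⟩)
  obtain ⟨m, hm⟩ := exists_int_dual ((u.restrictScalars ℤ) ∘ₗ (TensorProduct.mk ℤ ℝ N 1)) s hgen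
  replace hm : ∀ n ∈ s, 0 ≤ m n ∧ (m n = 0 ↔ u ((1 : ℝ) ⊗ₜ[ℤ] n) = 0) := hm
  have hm0 : ∀ n ∈ s, 0 ≤ m.baseChange ℝ ((1 : ℝ) ⊗ₜ[ℤ] n) :=
    fun n hn => by simpa using (hm n hn).1
  refine ⟨m, mem_dualMonoid.2 fun x hx => nonneg_of_hull (s := (s : Set N)) _ hm0 hx,
    fun x => (Set.ext_iff.1 hτ x).trans ⟨fun hx => ⟨hx.1, ?_⟩, fun hx => ⟨hx.1, ?_⟩⟩⟩
  · exact eq_zero_of_hull u _ hgen hm0 (fun n hn h0 => by simp [(hm n hn).2.2 h0]) hx.1 hx.2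
  · refine eq_zero_of_hull _ u hm0 hgen (fun n hn h0 => (hm n hn).2.1 ?_) hx.1 hx.2
    simpa using h0

/-- If `m` cuts out the face `τ` of `σ`, then `S_τ = S_σ + ℤ_{≥0} (-m)`. -/
theorem CutsOut.exists_add_mem {m : Module.Dual ℤ N} {τ σ : PointedCone ℝ (RealSpace N)}
    (h : CutsOut m τ σ) (hσ : IsRational σ) {w : Module.Dual ℤ N} (hw : w ∈ dualMonoid τ) :
    ∃ p : ℕ, ∀ q, p ≤ q → w + q • m ∈ dualMonoid σ := by
  obtain ⟨s, rfl⟩ := hσ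
  have hgen : ∀ n ∈ s, (1 : ℝ) ⊗ₜ[ℤ] n ∈
      PointedCone.hull ℝ ((fun n : N => (1 : ℝ) ⊗ₜ[ℤ] n) '' (s : Set N)) :=
    fun n hn => Submodule.subset_span ⟨n, hn, rfl⟩
  refine ⟨∑ n ∈ s, (w n).natAbs, fun q hq => mem_dualMonoid.2 fun x hx =>
    nonneg_of_hull (s := (s : Set N)) _ (fun n hn => ?_) hx⟩
  have hmn : 0 ≤ m n := by simpa using mem_dualMonoid.1 h.1 _ (hgen n hn)
  have h1 : 0 ≤ w n + (q : ℤ) * m n := by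
    rcases hmn.eq_or_lt with h0 | hpos
    · have : (0 : ℝ) ≤ w.baseChange ℝ (1 ⊗ₜ n) :=
        hw ((h.2 _).2 ⟨hgen n hn, by simp [h0.symm]⟩)
      have : 0 ≤ w n := by simpa using this
      rw [← h0]; simpa using this
    · have h3 : (w n).natAbs ≤ ∑ n ∈ s, (w n).natAbs :=
        Finset.single_le_sum (f := fun n => (w n).natAbs) (fun _ _ => Nat.zero_le _) hn
      have h5 : -(w n) ≤ (q : ℤ) := by omega
      nlinarith
  have h2 : (0 : ℝ) ≤ ((w n + (q : ℤ) * m n : ℤ) : ℝ) := by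
    exact_mod_cast h1
  simpa using h2

theorem CutsOut.neg_mem {m : Module.Dual ℤ N} {τ σ : PointedCone ℝ (RealSpace N)}
    (h : CutsOut m τ σ) : -m ∈ dualMonoid τ := by
  refine mem_dualMonoid.2 fun x hx => ?_
  simp [((h.2 x).1 hx).2]

theorem CutsOut.inf {m₁ m₂ : Module.Dual ℤ N} {τ₁ τ₂ σ : PointedCone ℝ (RealSpace N)}
    (h₁ : CutsOut m₁ τ₁ σ) (h₂ : CutsOut m₂ τ₂ σ) : CutsOut (m₁ + m₂) (τ₁ ⊓ τ₂) σ := by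
  refine ⟨add_mem h₁.1 h₂.1, fun x => ?_⟩
  rw [Submodule.mem_inf, h₁.2, h₂.2, map_add, LinearMap.add_apply]
  constructor
  · rintro ⟨⟨h, h1⟩, -, h2⟩
    exact ⟨h, by simp [h1, h2]⟩
  · rintro ⟨h, h0⟩
    have a1 := mem_dualMonoid.1 h₁.1 x h
    have a2 := mem_dualMonoid.1 h₂.1 x h
    exact ⟨⟨h, by linarith⟩, h, by linarith⟩

end Cones

section Charts

variable (k : Type u) [Field k] {N : Type v} [AddCommGroup N]

/-- The coordinate ring `k[S_σ]`. -/
abbrev coordRing (σ : PointedCone ℝ (RealSpace N)) : Type (max u v) :=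
  AddMonoidAlgebra k (dualMonoid σ)

/-- The homomorphism `k[S_σ] → k[S_τ]` induced by an inclusion of cones `τ ⊆ σ`. -/
def coordMap {τ σ : PointedCone ℝ (RealSpace N)} (h : τ ≤ σ) : coordRing k σ →+* coordRing k τ :=
  AddMonoidAlgebra.mapDomainRingHom k (AddSubmonoid.inclusion (dualMonoid_anti h))

/-- `U_σ = Spec k[S_σ]`, as a scheme; its closed points are the points of the classical variety. -/
abbrev chart (σ : PointedCone ℝ (RealSpace N)) : Scheme.{max u v} :=
  Spec (CommRingCat.of (coordRing k σ))

/-- The morphism `U_τ → U_σ` induced by an inclusion of cones `τ ⊆ σ`. -/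
def chartMap {τ σ : PointedCone ℝ (RealSpace N)} (h : τ ≤ σ) :
    chart.{u, v} k τ ⟶ chart.{u, v} k σ :=
  Spec.map (CommRingCat.ofHom (coordMap k h))

theorem chartMap_refl (σ : PointedCone ℝ (RealSpace N)) : chartMap k (le_refl σ) = 𝟙 _ := by
  have : coordMap k (le_refl σ) = RingHom.id _ :=
    AddMonoidAlgebra.mapDomainRingHom_id
  rw [chartMap, this]
  exact Spec.map_id _

theorem chartMap_comp {ρ τ σ : PointedCone ℝ (RealSpace N)} (h₁ : ρ ≤ τ) (h₂ : τ ≤ σ) :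
    chartMap k h₁ ≫ chartMap k h₂ = chartMap k (h₁.trans h₂) := by
  have : coordMap k (h₁.trans h₂) = (coordMap k h₁).comp (coordMap k h₂) :=
    AddMonoidAlgebra.mapDomainRingHom_comp (AddSubmonoid.inclusion (dualMonoid_anti h₁))
      (AddSubmonoid.inclusion (dualMonoid_anti h₂))
  rw [chartMap, chartMap, chartMap, this, CommRingCat.ofHom_comp, Spec.map_comp]

theorem coordMap_injective {τ σ : PointedCone ℝ (RealSpace N)} (h : τ ≤ σ) :
    Function.Injective (coordMap k h) :=
  AddMonoidAlgebra.mapDomain_injective (AddSubmonoid.inclusion_injective (dualMonoid_anti h))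

theorem coordMap_single {τ σ : PointedCone ℝ (RealSpace N)} (h : τ ≤ σ) (w : dualMonoid σ) (a : k) :
    coordMap k h (AddMonoidAlgebra.single w a) =
      AddMonoidAlgebra.single (AddSubmonoid.inclusion (dualMonoid_anti h) w) a :=
  AddMonoidAlgebra.mapDomain_single

/-- `k[S_τ]` is the localization of `k[S_σ]` at the monomial `χ^m`. -/
theorem isLocalization_away {m : Module.Dual ℤ N} {τ σ : PointedCone ℝ (RealSpace N)}
    (hm : CutsOut m τ σ) (hσ : IsRational σ) (h : τ ≤ σ) :
    letI := (coordMap k h).toAlgebra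
    IsLocalization.Away (AddMonoidAlgebra.single (⟨m, hm.mem⟩ : dualMonoid σ) (1 : k))
      (coordRing k τ) := by
  let _ := (coordMap k h).toAlgebra
  have hpow : ∀ n : ℕ, coordMap k h
      (AddMonoidAlgebra.single (⟨m, hm.mem⟩ : dualMonoid σ) (1 : k) ^ n) =
      AddMonoidAlgebra.single (n • ⟨m, dualMonoid_anti h hm.mem⟩ : dualMonoid τ) (1 : k) := by
    intro n
    rw [map_pow, coordMap_single, AddMonoidAlgebra.single_pow, one_pow]
    rfl
  refine IsLocalization.Away.mk (r := AddMonoidAlgebra.single (⟨m, hm.mem⟩ : dualMonoid σ) (1 : k))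
    ?_ ?_ ?_
  · refine IsUnit.of_mul_eq_one (AddMonoidAlgebra.single (⟨-m, hm.neg_mem⟩ : dualMonoid τ) 1) ?_
    change coordMap k h _ * _ = 1
    rw [coordMap_single, AddMonoidAlgebra.single_mul_single, AddMonoidAlgebra.one_def, one_mul]
    congr 1
    exact Subtype.ext (add_neg_cancel m)
  · intro f
    obtain ⟨p, hp⟩ : ∃ p : ℕ, ∀ q, p ≤ q → ∃ g, coordMap k h g =
        f * AddMonoidAlgebra.single (q • ⟨m, dualMonoid_anti h hm.mem⟩ : dualMonoid τ) (1 : k) := by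
      induction f using AddMonoidAlgebra.induction_linear with
      | zero => exact ⟨0, fun q _ => ⟨0, by simp⟩⟩
      | add f g hf hg =>
        obtain ⟨p, hp⟩ := hf
        obtain ⟨p', hp'⟩ := hg
        refine ⟨max p p', fun q hq => ?_⟩
        obtain ⟨a, ha⟩ := hp q (le_of_max_le_left hq)
        obtain ⟨b, hb⟩ := hp' q (le_of_max_le_right hq)
        exact ⟨a + b, by rw [map_add, ha, hb, add_mul]⟩
      | single w a =>
        obtain ⟨p, hp⟩ := hm.exists_add_mem hσ w.2
        refine ⟨p, fun q hq => ⟨AddMonoidAlgebra.single ⟨_, hp q hq⟩ a, ?_⟩⟩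
        rw [coordMap_single, AddMonoidAlgebra.single_mul_single, mul_one]
        rfl
    obtain ⟨g, hg⟩ := hp p le_rfl
    refine ⟨p, g, ?_⟩
    change f * coordMap k h _ ^ p = coordMap k h g
    rw [← map_pow, hpow, hg]
  · intro a b hab
    exact ⟨0, by rw [coordMap_injective k h hab]⟩

theorem CutsOut.isOpenImmersion {m : Module.Dual ℤ N} {τ σ : PointedCone ℝ (RealSpace N)}
    (hm : CutsOut m τ σ) (hσ : IsRational σ) (h : τ ≤ σ) :
    IsOpenImmersion (chartMap.{u, v} k h) := by
  let _ := (coordMap k h).toAlgebra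
  have := isLocalization_away k hm hσ h
  exact IsOpenImmersion.of_isLocalization
    (AddMonoidAlgebra.single (⟨m, hm.mem⟩ : dualMonoid σ) (1 : k))

theorem CutsOut.mem_range {m : Module.Dual ℤ N} {τ σ : PointedCone ℝ (RealSpace N)}
    (hm : CutsOut m τ σ) (hσ : IsRational σ) (h : τ ≤ σ) (x : chart.{u, v} k σ) :
    x ∈ Set.range (chartMap.{u, v} k h) ↔
      AddMonoidAlgebra.single (⟨m, hm.mem⟩ : dualMonoid σ) (1 : k) ∉
        PrimeSpectrum.asIdeal (R := coordRing k σ) x := by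
  let _ := (coordMap k h).toAlgebra
  have := isLocalization_away k hm hσ h
  exact Set.ext_iff.1 (PrimeSpectrum.localization_away_comap_range (coordRing k τ)
    (AddMonoidAlgebra.single (⟨m, hm.mem⟩ : dualMonoid σ) (1 : k))) x

/-- For faces `τ₁`, `τ₂` of `σ`, the natural morphism `U_{τ₁ ∩ τ₂} → U_{τ₁} ×[U_σ] U_{τ₂}` is an
isomorphism. -/
theorem isIso_lift [Module.Finite ℤ N] {τ₁ τ₂ ρ σ : PointedCone ℝ (RealSpace N)}
    (hf₁ : IsFace τ₁ σ) (hf₂ : IsFace τ₂ σ) (hσ : IsRational σ) (h₁ : τ₁ ≤ σ) (h₂ : τ₂ ≤ σ)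
    (hρ₁ : ρ ≤ τ₁) (hρ₂ : ρ ≤ τ₂) (hρ : ρ = τ₁ ⊓ τ₂) :
    IsIso (pullback.lift (f := chartMap.{u, v} k h₁) (g := chartMap.{u, v} k h₂)
      (chartMap.{u, v} k hρ₁) (chartMap.{u, v} k hρ₂)
      (by rw [chartMap_comp, chartMap_comp])) := by
  subst hρ
  obtain ⟨m₁, hm₁⟩ := hf₁.exists_cutsOut hσ
  obtain ⟨m₂, hm₂⟩ := hf₂.exists_cutsOut hσ
  have := hm₁.isOpenImmersion k hσ h₁
  have := hm₂.isOpenImmersion k hσ h₂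
  have := (hm₁.inf hm₂).isOpenImmersion k hσ (hρ₁.trans h₁)
  let p : pullback (chartMap.{u, v} k h₁) (chartMap.{u, v} k h₂) ⟶ chart.{u, v} k σ :=
    pullback.fst _ _ ≫ chartMap.{u, v} k h₁
  have hp : p = pullback.snd _ _ ≫ chartMap.{u, v} k h₂ := pullback.condition
  have : IsOpenImmersion p := inferInstanceAs (IsOpenImmersion (_ ≫ _))
  let g : chart.{u, v} k (τ₁ ⊓ τ₂) ⟶ pullback (chartMap.{u, v} k h₁) (chartMap.{u, v} k h₂) :=
    pullback.lift (chartMap.{u, v} k hρ₁) (chartMap.{u, v} k hρ₂)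
      (by rw [chartMap_comp, chartMap_comp])
  have hg : g ≫ p = chartMap.{u, v} k (hρ₁.trans h₁) := by
    rw [pullback.lift_fst_assoc, chartMap_comp]
  have : IsOpenImmersion (g ≫ p) := by rw [hg]; assumption
  have : IsOpenImmersion g := IsOpenImmersion.of_comp g p
  have hsurj : Function.Surjective g := by
    intro x
    have hx₁ : p x ∈ Set.range (chartMap.{u, v} k h₁) := ⟨(pullback.fst (chartMap.{u, v} k h₁) (chartMap.{u, v} k h₂)) x, rfl⟩
    have hx₂ : p x ∈ Set.range (chartMap.{u, v} k h₂) := by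
      rw [hp]; exact ⟨(pullback.snd (chartMap.{u, v} k h₁) (chartMap.{u, v} k h₂)) x, rfl⟩
    have hx : p x ∈ Set.range (chartMap.{u, v} k (hρ₁.trans h₁)) := by
      rw [hm₁.mem_range k hσ] at hx₁
      rw [hm₂.mem_range k hσ] at hx₂
      rw [(hm₁.inf hm₂).mem_range k hσ]
      intro h
      have hmul : (AddMonoidAlgebra.single (⟨m₁ + m₂, (hm₁.inf hm₂).mem⟩ : dualMonoid σ) (1 : k)) =
          AddMonoidAlgebra.single (⟨m₁, hm₁.mem⟩ : dualMonoid σ) 1 *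
          AddMonoidAlgebra.single (⟨m₂, hm₂.mem⟩ : dualMonoid σ) 1 := by
        rw [AddMonoidAlgebra.single_mul_single, one_mul]
        rfl
      rw [hmul] at h
      exact ((PrimeSpectrum.isPrime (R := coordRing k σ) (p x)).mem_or_mem h).elim hx₁ hx₂
    obtain ⟨z, hz⟩ := hx
    refine ⟨z, p.isOpenEmbedding.injective ?_⟩
    rw [← hz, ← hg]
    rfl
  have : Surjective g := ⟨hsurj⟩
  exact (isIso_iff_isOpenImmersion_and_epi_base g).2
    ⟨inferInstance, (TopCat.epi_iff_surjective _).2 hsurj⟩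

/-- The natural morphism `U_{σ ∩ τ ∩ ρ} → U_{σ ∩ τ} ×[U_σ] U_{σ ∩ ρ}`. -/
def tripleMap (σ τ ρ : PointedCone ℝ (RealSpace N)) :
    chart.{u, v} k (σ ⊓ τ ⊓ ρ) ⟶
      pullback (chartMap.{u, v} k (inf_le_left : σ ⊓ τ ≤ σ))
        (chartMap.{u, v} k (inf_le_left : σ ⊓ ρ ≤ σ)) :=
  pullback.lift (chartMap.{u, v} k inf_le_left)
    (chartMap.{u, v} k (inf_le_inf_right ρ inf_le_left))
    (by rw [chartMap_comp, chartMap_comp])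

theorem tripleMap_fst (σ τ ρ : PointedCone ℝ (RealSpace N)) :
    tripleMap.{u, v} k σ τ ρ ≫ pullback.fst _ _ = chartMap.{u, v} k inf_le_left :=
  pullback.lift_fst _ _ _

theorem tripleMap_snd (σ τ ρ : PointedCone ℝ (RealSpace N)) :
    tripleMap.{u, v} k σ τ ρ ≫ pullback.snd _ _ =
      chartMap.{u, v} k (inf_le_inf_right ρ inf_le_left) :=
  pullback.lift_snd _ _ _

end Charts

/-- A fan in `N_ℝ`: a nonempty finite collection of strongly convex rational polyhedral cones that
contains the faces of its members and in which two cones intersect in a common face.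
`PointedCone.DualFG` says that the cone is an intersection of finitely many closed half-spaces
`{x | 0 ≤ u x}`, and `ConvexCone.Salient` that it contains no line. -/
structure Fan (N : Type v) [AddCommGroup N] where
  /-- The cones of the fan. -/
  cones : Set (PointedCone ℝ (RealSpace N))
  finite : cones.Finite
  nonempty : cones.Nonempty
  stronglyConvex : ∀ σ ∈ cones, σ.toConvexCone.Salient
  polyhedral : ∀ σ ∈ cones, σ.DualFG LinearMap.id
  rational : ∀ σ ∈ cones, IsRational σ
  face_mem : ∀ σ ∈ cones, ∀ τ, IsFace τ σ → τ ∈ cones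
  inter_isFace : ∀ σ ∈ cones, ∀ τ ∈ cones, IsFace (σ ⊓ τ) σ ∧ IsFace (σ ⊓ τ) τ

namespace Fan

variable {N : Type v} [AddCommGroup N]

/-- `Δ` is generated by `σ ∈ Δ`: it consists of `σ` together with all of its faces. -/
def IsGeneratedBy (Δ : Fan N) (σ : PointedCone ℝ (RealSpace N)) : Prop :=
  σ ∈ Δ.cones ∧ Δ.cones = insert σ {τ | IsFace τ σ}

variable [Module.Finite ℤ N] (k : Type u) [Field k] (Δ : Fan N)

theorem isOpenImmersion_inf (σ τ : Δ.cones) :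
    IsOpenImmersion (chartMap.{u, v} k (inf_le_left : σ.1 ⊓ τ.1 ≤ σ.1)) := by
  obtain ⟨m, hm⟩ := (Δ.inter_isFace _ σ.2 _ τ.2).1.exists_cutsOut (Δ.rational _ σ.2)
  exact hm.isOpenImmersion k (Δ.rational _ σ.2) _

instance isIso_tripleMap (σ τ ρ : Δ.cones) : IsIso (tripleMap.{u, v} k σ.1 τ.1 ρ.1) :=
  isIso_lift.{u, v} k (Δ.inter_isFace _ σ.2 _ τ.2).1 (Δ.inter_isFace _ σ.2 _ ρ.2).1
    (Δ.rational _ σ.2) inf_le_left inf_le_left _ _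
    (le_antisymm (le_inf inf_le_left (inf_le_inf_right _ inf_le_left))
      (le_inf inf_le_left (inf_le_right.trans inf_le_right)))

/-- The gluing data of `X(Δ)`: the charts `U_σ`, `σ ∈ Δ`, where `U_σ` and `U_τ` are glued along
`U_{σ ∩ τ}`. -/
def glueData : Scheme.GlueData.{max u v} where
  J := ULift.{u} Δ.cones
  U σ := chart.{u, v} k σ.down.1
  V p := chart.{u, v} k (p.1.down.1 ⊓ p.2.down.1)
  f σ τ := chartMap.{u, v} k (inf_le_left : σ.down.1 ⊓ τ.down.1 ≤ σ.down.1)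
  f_open σ τ := Δ.isOpenImmersion_inf k σ.down τ.down
  f_mono σ τ := by
    have := Δ.isOpenImmersion_inf k σ.down τ.down
    infer_instance
  f_hasPullback σ τ ρ := by
    have := Δ.isOpenImmersion_inf k σ.down τ.down
    infer_instance
  f_id σ := ⟨chartMap.{u, v} k (le_inf le_rfl le_rfl : σ.down.1 ≤ σ.down.1 ⊓ σ.down.1),
    by rw [chartMap_comp, chartMap_refl], by rw [chartMap_comp, chartMap_refl]⟩
  t σ τ := chartMap.{u, v} k (inf_comm σ.down.1 τ.down.1).le
  t_id σ := chartMap_refl.{u, v} k _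
  t' σ τ ρ :=
    inv (tripleMap.{u, v} k σ.down.1 τ.down.1 ρ.down.1) ≫
      chartMap.{u, v} k ((inf_assoc _ _ _).trans (inf_comm _ _)).le ≫
        tripleMap.{u, v} k τ.down.1 ρ.down.1 σ.down.1
  t_fac σ τ ρ := by
    rw [Category.assoc, Category.assoc, tripleMap_snd, IsIso.inv_comp_eq, chartMap_comp,
      ← Category.assoc, tripleMap_fst, chartMap_comp]
  cocycle σ τ ρ := by
    simp only [Category.assoc, IsIso.hom_inv_id_assoc]
    rw [IsIso.inv_comp_eq, Category.comp_id, ← Category.assoc, ← Category.assoc, chartMap_comp,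
      chartMap_comp, chartMap_refl, Category.id_comp]

/-- The toric variety `X(Δ)` over `k`: the charts `U_σ` glued along the `U_{σ ∩ τ}`. -/
def toricVariety : Scheme.{max u v} := (Δ.glueData.{u, v} k).glued

end Fan

end Toric

end

/-! If `Δ` is generated by `σ`, every chart factors through `U_σ`, so `U_σ → X(Δ)` is a surjective
open immersion, hence an isomorphism.

Conversely let `X(Δ)` be affine with ring of functions `A`. Restricted to the charts and viewed in
`k[M]`, a function has only one expansion in characters, so its characters lie in `S`, the
intersection of all `S_σ`. This gives `A → k[S]` (`exists_lift_of_compatible`). Monomials outside a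
face of a monoid span a prime ideal. The prime of `k[S]` belonging to the units of `S` pulls back to
a point `y` of `Spec A = X(Δ)`. It lies in some `U_σ`, together with a basic neighbourhood `D(f)`
inside `U_σ`; some unit `w` of `S` occurs in `f`.

This `σ` contains every `τ` in `Δ`. For `x ∈ τ`, the characters of `S_τ` vanishing at `x` form a
face, with prime `p` in `U_τ`. Both `w` and `-w` are nonnegative on `τ`, so `w` vanishes at `x`,
hence `f ∉ p` and `p ∈ D(f) ⊆ U_σ`. Thus `p` lies in `U_{σ ∩ τ}`, where the character cutting out `σ
∩ τ` in `τ` is invertible. If `x ∉ σ`, that character is nonzero at `x` and so belongs to `p`, a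
contradiction. -/

noncomputable section

/-! ### Faces of a monoid and prime ideals of its algebra -/

namespace AddMonoidAlgebra

variable {R P : Type*} [CommRing R] [AddCommMonoid P]

/-- `T` is a face of the monoid `P`: a submonoid containing the summands of its elements. -/
def IsFaceSubmonoid (T : AddSubmonoid P) : Prop :=
  ∀ a b, a + b ∈ T → a ∈ T ∧ b ∈ T

variable (R) in
open scoped Classical in
/-- The endomorphism of `R[P]` that keeps the monomials in a face of `P` and kills the others. -/
def faceHom (T : AddSubmonoid P) (hT : IsFaceSubmonoid T) :
    AddMonoidAlgebra R P →ₐ[R] AddMonoidAlgebra R P :=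
  AddMonoidAlgebra.lift R _ P
    { toFun := fun w => if w.toAdd ∈ T then single w.toAdd 1 else 0
      map_one' := by simp [one_def]
      map_mul' := fun a b => by
        -- Multiplicativity holds because a sum lies in a face exactly when both summands do.
        by_cases hab : a.toAdd + b.toAdd ∈ T
        · simp [hab, hT _ _ hab, single_mul_single]
        · by_cases ha : a.toAdd ∈ T
          · have hb : b.toAdd ∉ T := fun hb => hab (T.add_mem ha hb)
            simp [hab, hb]
          · simp [hab, ha] }

theorem coeff_faceHom_of_mem {T : AddSubmonoid P} (hT : IsFaceSubmonoid T)
    (f : AddMonoidAlgebra R P) {w : P} (hw : w ∈ T) :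
    (faceHom R T hT f).coeff w = f.coeff w := by
  classical
  induction f using AddMonoidAlgebra.induction_linear with
  | zero => simp
  | add f g hf hg => simp [hf, hg]
  | single a r =>
    by_cases ha : a ∈ T
    · simp [faceHom, ha]
    · have : a ≠ w := fun h => ha (h ▸ hw)
      simp [faceHom, ha, this]

theorem coeff_faceHom_of_notMem {T : AddSubmonoid P} (hT : IsFaceSubmonoid T)
    (f : AddMonoidAlgebra R P) {w : P} (hw : w ∉ T) :
    (faceHom R T hT f).coeff w = 0 := by
  classical
  induction f using AddMonoidAlgebra.induction_linear with
  | zero => simp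
  | add f g hf hg => simp [hf, hg]
  | single a r =>
    by_cases ha : a ∈ T
    · have : a ≠ w := fun h => hw (h ▸ ha)
      simp [faceHom, ha, this]
    · simp [faceHom, ha]

variable (R) in
/-- The ideal spanned by the monomials outside a face. -/
def faceIdeal (T : AddSubmonoid P) (hT : IsFaceSubmonoid T) : Ideal (AddMonoidAlgebra R P) :=
  RingHom.ker (faceHom R T hT)

theorem mem_faceIdeal {T : AddSubmonoid P} (hT : IsFaceSubmonoid T) {f : AddMonoidAlgebra R P} :
    f ∈ faceIdeal R T hT ↔ ∀ w ∈ T, f.coeff w = 0 := by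
  rw [faceIdeal, RingHom.mem_ker]
  constructor
  · intro h w hw
    rw [← coeff_faceHom_of_mem hT f hw, h, coeff_zero, Finsupp.zero_apply]
  · intro h
    ext w
    by_cases hw : w ∈ T
    · rw [coeff_faceHom_of_mem hT f hw, h w hw, coeff_zero, Finsupp.zero_apply]
    · rw [coeff_faceHom_of_notMem hT f hw, coeff_zero, Finsupp.zero_apply]

/-- Unique sums make `R[P]` a domain, and the kernel of a ring homomorphism into a domain is prime.
-/
theorem isPrime_faceIdeal [IsDomain R] [UniqueSums P] {T : AddSubmonoid P}
    (hT : IsFaceSubmonoid T) : (faceIdeal R T hT).IsPrime :=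
  RingHom.ker_isPrime _

end AddMonoidAlgebra

/-! ### Coordinate rings inside `k[M]` and faces of `S_σ` -/

namespace Toric

variable (k : Type u) [Field k] {N : Type v} [AddCommGroup N]

/-- `M` is isomorphic to some `ℤ^n`, which has unique sums. The property passes to each `S_σ` and
makes face ideals prime. -/
instance uniqueSums_dual [Module.Finite ℤ N] [Module.Free ℤ N] : UniqueSums (Module.Dual ℤ N) :=
  let e := (Module.finBasis ℤ (Module.Dual ℤ N)).equivFun
  UniqueSums.of_injective_addHom (e.toAddEquiv : _ ≃+ (Fin _ → ℤ)).toAddHom e.injective inferInstance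

instance uniqueSums_dualMonoid [Module.Finite ℤ N] [Module.Free ℤ N]
    (σ : PointedCone ℝ (RealSpace N)) : UniqueSums (dualMonoid σ) :=
  UniqueSums.of_injective_addHom (dualMonoid σ).subtype.toAddHom Subtype.val_injective inferInstance

/-- The inclusion `k[S_σ] → k[M]`. -/
def torusMap (σ : PointedCone ℝ (RealSpace N)) :
    coordRing k σ →+* AddMonoidAlgebra k (Module.Dual ℤ N) :=
  AddMonoidAlgebra.mapDomainRingHom k (dualMonoid σ).subtype

theorem torusMap_injective (σ : PointedCone ℝ (RealSpace N)) :
    Function.Injective (torusMap k σ) :=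
  AddMonoidAlgebra.mapDomain_injective Subtype.val_injective

theorem torusMap_comp_coordMap {τ σ : PointedCone ℝ (RealSpace N)} (h : τ ≤ σ) :
    (torusMap k τ).comp (coordMap k h) = torusMap k σ :=
  (AddMonoidAlgebra.mapDomainRingHom_comp (dualMonoid τ).subtype
    (AddSubmonoid.inclusion (dualMonoid_anti h))).symm

theorem coeff_torusMap {σ : PointedCone ℝ (RealSpace N)} (f : coordRing k σ) (w : dualMonoid σ) :
    (torusMap k σ f).coeff w = f.coeff w :=
  Finsupp.mapDomain_apply Subtype.val_injective f.coeff w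

theorem coeff_torusMap_of_notMem {σ : PointedCone ℝ (RealSpace N)} (f : coordRing k σ)
    {w : Module.Dual ℤ N} (hw : w ∉ dualMonoid σ) : (torusMap k σ f).coeff w = 0 :=
  Finsupp.mapDomain_of_notMem_range f.coeff w (by simpa using hw)

theorem mem_range_torusMap {σ : PointedCone ℝ (RealSpace N)}
    {f : AddMonoidAlgebra k (Module.Dual ℤ N)} (hf : ∀ w, f.coeff w ≠ 0 → w ∈ dualMonoid σ) :
    f ∈ (torusMap k σ).range := by
  rw [← AddMonoidAlgebra.sum_coeff_single f]
  refine Subring.sum_mem _ fun w hw => ?_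
  exact ⟨AddMonoidAlgebra.single ⟨w, hf w (Finsupp.mem_support_iff.1 hw)⟩ (f.coeff w),
    AddMonoidAlgebra.mapDomain_single⟩

/-- Preimages chosen elementwise form a homomorphism because `torusMap` is injective. -/
theorem exists_lift_torusMap {A : Type*} [Ring A] {σ : PointedCone ℝ (RealSpace N)}
    (φ : A →+* AddMonoidAlgebra k (Module.Dual ℤ N))
    (hφ : ∀ a w, (φ a).coeff w ≠ 0 → w ∈ dualMonoid σ) :
    ∃ ψ : A →+* coordRing k σ, (torusMap k σ).comp ψ = φ := by
  choose g hg using fun a => mem_range_torusMap k (hφ a)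
  have inj := torusMap_injective k σ
  exact ⟨{ toFun := g
           map_one' := inj (by rw [hg, map_one, map_one])
           map_mul' := fun a b => inj (by rw [hg, map_mul, map_mul, hg, hg])
           map_zero' := inj (by rw [hg, map_zero, map_zero])
           map_add' := fun a b => inj (by rw [hg, map_add, map_add, hg, hg]) }, RingHom.ext hg⟩

/-- The submonoid of units of `S_σ`. -/
def unitFace (σ : PointedCone ℝ (RealSpace N)) : AddSubmonoid (dualMonoid σ) where
  carrier := {w | -w.1 ∈ dualMonoid σ}
  zero_mem' := by simp
  add_mem' {a b} ha hb := by
    change -(a.1 + b.1) ∈ dualMonoid σ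
    rw [neg_add]
    exact add_mem ha hb

theorem isFaceSubmonoid_unitFace (σ : PointedCone ℝ (RealSpace N)) :
    AddMonoidAlgebra.IsFaceSubmonoid (unitFace σ) := by
  intro a b h
  replace h : -(a.1 + b.1) ∈ dualMonoid σ := h
  constructor
  · change -a.1 ∈ dualMonoid σ
    simpa using add_mem h b.2
  · change -b.1 ∈ dualMonoid σ
    simpa using add_mem h a.2

/-- The elements of `S_σ` that vanish at `x`. -/
def orthFace (σ : PointedCone ℝ (RealSpace N)) (x : RealSpace N) :
    AddSubmonoid (dualMonoid σ) where
  carrier := {w | w.1.baseChange ℝ x = 0}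
  zero_mem' := by simp
  add_mem' {a b} ha hb := by
    change (a.1 + b.1).baseChange ℝ x = 0
    rw [map_add, LinearMap.add_apply, show a.1.baseChange ℝ x = 0 from ha,
      show b.1.baseChange ℝ x = 0 from hb, add_zero]

theorem isFaceSubmonoid_orthFace {σ : PointedCone ℝ (RealSpace N)} {x : RealSpace N}
    (hx : x ∈ σ) : AddMonoidAlgebra.IsFaceSubmonoid (orthFace σ x) := by
  intro a b h
  replace h : (a.1 + b.1).baseChange ℝ x = 0 := h
  rw [map_add, LinearMap.add_apply] at h
  have ha := mem_dualMonoid.1 a.2 x hx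
  have hb := mem_dualMonoid.1 b.2 x hx
  exact ⟨show a.1.baseChange ℝ x = 0 by linarith, show b.1.baseChange ℝ x = 0 by linarith⟩

/-- The half-space where `w` is nonnegative is itself a cone, so it contains the supremum once it
contains each member. The supremum may contain lines; only its dual monoid is used. -/
theorem mem_dualMonoid_sSup {C : Set (PointedCone ℝ (RealSpace N))} {w : Module.Dual ℤ N}
    (h : ∀ σ ∈ C, w ∈ dualMonoid σ) : w ∈ dualMonoid (sSup C) := by
  have : sSup C ≤ PointedCone.dual LinearMap.id {w.baseChange ℝ} := by
    refine sSup_le fun σ hσ x hx => ?_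
    rw [PointedCone.mem_dual]
    rintro _ rfl
    exact mem_dualMonoid.1 (h σ hσ) x hx
  exact fun x hx => this hx rfl

/-! ### Functions compatible on all charts -/

namespace Fan

variable (Δ : Fan N)

/-- Compatible homomorphisms to the coordinate rings of all charts have values in the combinations of
characters that are nonnegative on all cones of the fan. -/
theorem exists_lift_of_compatible {A : Type*} [Ring A] (φ : ∀ σ : Δ.cones, A →+* coordRing k σ.1)
    (hφ : ∀ σ τ : Δ.cones, (torusMap k σ.1).comp (φ σ) = (torusMap k τ.1).comp (φ τ)) :
    ∃ ψ : A →+* coordRing k (sSup Δ.cones),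
      ∀ τ : Δ.cones, (torusMap k (sSup Δ.cones)).comp ψ = (torusMap k τ.1).comp (φ τ) := by
  obtain ⟨σ, hσ⟩ := Δ.nonempty
  have hsupp : ∀ a w, ((torusMap k σ).comp (φ ⟨σ, hσ⟩) a).coeff w ≠ 0 →
      w ∈ dualMonoid (sSup Δ.cones) := by
    refine fun a w hw => mem_dualMonoid_sSup fun τ hτ => ?_
    -- The coefficient at `w` can equally be read off in the chart of `τ`, where only characters in
    -- `S_τ` occur.
    by_contra hwτ
    refine hw ?_
    rw [hφ ⟨σ, hσ⟩ ⟨τ, hτ⟩]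
    exact coeff_torusMap_of_notMem k (φ ⟨τ, hτ⟩ a) hwτ
  obtain ⟨ψ, hψ⟩ := exists_lift_torusMap k _ hsupp
  exact ⟨ψ, fun τ => hψ.trans (hφ ⟨σ, hσ⟩ τ)⟩

/-! ### The charts as an open cover of `X(Δ)` -/

variable [Module.Finite ℤ N]

/-- The inclusion of the chart `U_σ` in the toric variety. -/
def chartι (σ : Δ.cones) : chart.{u, v} k σ.1 ⟶ Δ.toricVariety.{u, v} k :=
  (Δ.glueData.{u, v} k).ι ⟨σ⟩

instance (σ : Δ.cones) : IsOpenImmersion (Δ.chartι k σ) :=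
  (Δ.glueData.{u, v} k).ι_isOpenImmersion ⟨σ⟩

theorem exists_chartι_eq (x : Δ.toricVariety.{u, v} k) :
    ∃ (σ : Δ.cones) (y : chart.{u, v} k σ.1), Δ.chartι k σ y = x := by
  obtain ⟨σ, y, h⟩ := (Δ.glueData.{u, v} k).ι_jointly_surjective x
  exact ⟨σ.down, y, h⟩

theorem chartMap_chartι (σ τ : Δ.cones) :
    chartMap.{u, v} k (inf_le_right : σ.1 ⊓ τ.1 ≤ τ.1) ≫ Δ.chartι k τ =
      chartMap.{u, v} k (inf_le_left : σ.1 ⊓ τ.1 ≤ σ.1) ≫ Δ.chartι k σ := by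
  rw [← chartMap_comp k (inf_comm σ.1 τ.1).le inf_le_left, Category.assoc]
  exact (Δ.glueData.{u, v} k).glue_condition ⟨σ⟩ ⟨τ⟩

/-- Inside `X(Δ)`, the charts `U_σ` and `U_τ` meet only in `U_{σ ∩ τ}`: the gluing identifies no
other points. -/
theorem mem_range_chartMap_of_chartι_eq {σ τ : Δ.cones} {x : chart.{u, v} k σ.1}
    {y : chart.{u, v} k τ.1} (h : Δ.chartι k σ x = Δ.chartι k τ y) :
    x ∈ Set.range (chartMap.{u, v} k (inf_le_left : σ.1 ⊓ τ.1 ≤ σ.1)) := by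
  obtain ⟨z, hz, -⟩ := ((Δ.glueData.{u, v} k).ι_eq_iff ⟨σ⟩ ⟨τ⟩ x y).1 h
  exact ⟨z, hz⟩

theorem isAffine_of_isGeneratedBy {σ : PointedCone ℝ (RealSpace N)} (h : Δ.IsGeneratedBy σ) :
    IsAffine (Δ.toricVariety.{u, v} k) := by
  let s : Δ.cones := ⟨σ, h.1⟩
  have hsurj : Function.Surjective (Δ.chartι.{u, v} k s) := by
    intro x
    obtain ⟨τ, y, rfl⟩ := Δ.exists_chartι_eq k x
    have hle : τ.1 ≤ σ := by
      rcases h.2.subset τ.2 with h | h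
      · exact h.le
      · exact h.le
    have hcomp : chartMap.{u, v} k hle ≫ Δ.chartι k s = Δ.chartι k τ := by
      -- Since `τ ≤ σ ⊓ τ`, the gluing relation can be precomposed with `U_τ → U_{σ ∩ τ}`; one side
      -- then collapses to the chart of `τ`.
      have := congrArg (chartMap.{u, v} k (le_inf hle le_rfl : τ.1 ≤ σ ⊓ τ.1) ≫ ·)
        (Δ.chartMap_chartι k s τ)
      simp only [← Category.assoc] at this
      rw [chartMap_comp, chartMap_comp, chartMap_refl, Category.id_comp] at this
      exact this.symm
    exact ⟨chartMap.{u, v} k hle y, by rw [← hcomp]; rfl⟩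
  have : IsIso (Δ.chartι.{u, v} k s) :=
    (isIso_iff_isOpenImmersion_and_epi_base _).2
      ⟨inferInstance, (TopCat.epi_iff_surjective _).2 hsurj⟩
  exact IsAffine.of_isIso (inv (Δ.chartι.{u, v} k s))

/-! ### Affineness forces a largest cone -/

/-- The restriction of global functions on an affine toric variety to the chart `U_σ`. -/
def sectionsMap [IsAffine (Δ.toricVariety.{u, v} k)] (σ : Δ.cones) :
    Γ(Δ.toricVariety.{u, v} k, ⊤) →+* coordRing k σ.1 :=
  (Spec.preimage (Δ.chartι k σ ≫ (Δ.toricVariety k).isoSpec.hom)).hom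

theorem specMap_sectionsMap [IsAffine (Δ.toricVariety.{u, v} k)] (σ : Δ.cones) :
    Spec.map (CommRingCat.ofHom (Δ.sectionsMap k σ)) =
      Δ.chartι k σ ≫ (Δ.toricVariety k).isoSpec.hom :=
  Spec.map_preimage _

/-- The two restrictions agree on the overlap `U_{σ ∩ τ}`, and both inclusions into `k[M]` factor
through `k[S_{σ ∩ τ}]`. -/
theorem torusMap_comp_sectionsMap [IsAffine (Δ.toricVariety.{u, v} k)] (σ τ : Δ.cones) :
    (torusMap k σ.1).comp (Δ.sectionsMap k σ) = (torusMap k τ.1).comp (Δ.sectionsMap k τ) := by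
  have h : (coordMap k (inf_le_left : σ.1 ⊓ τ.1 ≤ σ.1)).comp (Δ.sectionsMap k σ) =
      (coordMap k (inf_le_right : σ.1 ⊓ τ.1 ≤ τ.1)).comp (Δ.sectionsMap k τ) := by
    have : Spec.map (CommRingCat.ofHom
        ((coordMap k (inf_le_left : σ.1 ⊓ τ.1 ≤ σ.1)).comp (Δ.sectionsMap k σ))) =
      Spec.map (CommRingCat.ofHom
        ((coordMap k (inf_le_right : σ.1 ⊓ τ.1 ≤ τ.1)).comp (Δ.sectionsMap k τ))) := by
      rw [CommRingCat.ofHom_comp, CommRingCat.ofHom_comp, Spec.map_comp, Spec.map_comp,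
        specMap_sectionsMap, specMap_sectionsMap, ← Category.assoc, ← Category.assoc]
      exact congrArg (· ≫ _) (Δ.chartMap_chartι k σ τ).symm
    exact congrArg CommRingCat.Hom.hom (Spec.map_injective this)
  rw [← torusMap_comp_coordMap k (inf_le_left : σ.1 ⊓ τ.1 ≤ σ.1),
    ← torusMap_comp_coordMap k (inf_le_right : σ.1 ⊓ τ.1 ≤ τ.1), RingHom.comp_assoc,
    RingHom.comp_assoc, h]

theorem exists_forall_le_of_isAffine [Module.Free ℤ N] [IsAffine (Δ.toricVariety.{u, v} k)] :
    ∃ σ ∈ Δ.cones, ∀ τ ∈ Δ.cones, τ ≤ σ := by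
  let A := Γ(Δ.toricVariety.{u, v} k, ⊤)
  obtain ⟨ψ, hψ⟩ := Δ.exists_lift_of_compatible (A := A) k (Δ.sectionsMap k)
    (Δ.torusMap_comp_sectionsMap k)
  have hunit := isFaceSubmonoid_unitFace (sSup Δ.cones)
  have := AddMonoidAlgebra.isPrime_faceIdeal (R := k) hunit
  -- The candidate for a point of the smallest stratum: its prime consists of the functions in which
  -- no unit of `S` occurs.
  let y : Spec A := (⟨(AddMonoidAlgebra.faceIdeal k _ hunit).comap ψ, inferInstance⟩ :
    PrimeSpectrum A)
  obtain ⟨σ, z, hz⟩ := Δ.exists_chartι_eq k ((Δ.toricVariety.{u, v} k).isoSpec.inv y)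
  let h : ∀ τ : Δ.cones, chart.{u, v} k τ.1 ⟶ Spec A :=
    fun τ => Δ.chartι k τ ≫ (Δ.toricVariety k).isoSpec.hom
  have hy : y ∈ Set.range (h σ) := by
    refine ⟨z, ?_⟩
    change (Δ.toricVariety k).isoSpec.hom (Δ.chartι k σ z) = y
    rw [hz]
    simp
  obtain ⟨_, ⟨_, ⟨f, rfl⟩, rfl⟩, hyf, hfσ⟩ :=
    PrimeSpectrum.isBasis_basic_opens.exists_subset_of_mem_open
      hy (h σ).isOpenEmbedding.isOpen_range
  obtain ⟨w, hw, hfw⟩ : ∃ w ∈ unitFace (sSup Δ.cones), (ψ f).coeff w ≠ 0 := by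
    by_contra! hall
    exact hyf ((AddMonoidAlgebra.mem_faceIdeal hunit).2 hall)
  refine ⟨σ, σ.2, fun τ hτ x hx => ?_⟩
  by_contra hxσ
  have horth := isFaceSubmonoid_orthFace hx
  have := AddMonoidAlgebra.isPrime_faceIdeal (R := k) horth
  -- The functions on `U_τ` whose characters are all nonzero at `x`.
  let p : chart.{u, v} k τ := (⟨AddMonoidAlgebra.faceIdeal k _ horth, inferInstance⟩ :
    PrimeSpectrum (coordRing k τ))
  have hf : Δ.sectionsMap k ⟨τ, hτ⟩ f ∈ AddMonoidAlgebra.faceIdeal k _ horth := by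
    by_contra hn
    have hp : h ⟨τ, hτ⟩ p ∈ Set.range (h σ) := by
      refine hfσ ?_
      -- Written as a map of spectra, `h ⟨τ, hτ⟩` pulls `D(f)` back to the basic open of the
      -- restriction of `f`, which is what `hn` expresses.
      rw [show h ⟨τ, hτ⟩ = _ from (Δ.specMap_sectionsMap k ⟨τ, hτ⟩).symm]
      exact hn
    obtain ⟨z', hz'⟩ := hp
    have heq : Δ.chartι k ⟨τ, hτ⟩ p = Δ.chartι k σ z' :=
      (Δ.toricVariety k).isoSpec.hom.isOpenEmbedding.injective hz'.symm
    have hmem := Δ.mem_range_chartMap_of_chartι_eq k heq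
    obtain ⟨m, hm⟩ := (Δ.inter_isFace _ hτ _ σ.2).1.exists_cutsOut (Δ.rational _ hτ)
    refine (hm.mem_range k (Δ.rational _ hτ) _ _).1 hmem
      ((AddMonoidAlgebra.mem_faceIdeal horth).2 fun w hw => ?_)
    -- A character `w` vanishing at `x` differs from `m`, since the zeros of `m` on `τ` lie in `σ`.
    -- Hence the monomial of `m` belongs to `p`.
    have hne : (⟨m, hm.mem⟩ : dualMonoid τ) ≠ w := by
      rintro rfl
      exact hxσ ((hm.mem_iff x).2 ⟨hx, hw⟩).2
    simp [hne]
  have hle := dualMonoid_anti (le_sSup hτ)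
  -- Being a unit of `S`, `w` has both signs nonnegative at `x`. So `hf` kills the coefficient at
  -- `w`, contradicting `hfw`.
  have hwx : w.1.baseChange ℝ x = 0 := by
    have h1 := mem_dualMonoid.1 (hle w.2) x hx
    have h2 := mem_dualMonoid.1 (hle hw) x hx
    rw [map_neg, LinearMap.neg_apply] at h2
    linarith
  refine hfw ?_
  have := (AddMonoidAlgebra.mem_faceIdeal horth).1 hf ⟨w.1, hle w.2⟩ hwx
  rw [← coeff_torusMap, ← this, ← coeff_torusMap]
  exact congrArg (fun g => g.coeff w.1) (RingHom.congr_fun (hψ ⟨τ, hτ⟩) f)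

end Fan

end Toric
end

theorem corollary3p9 (k : Type u) [Field k] [IsAlgClosed k]
    (N : Type v) [AddCommGroup N] [Module.Free ℤ N] [Module.Finite ℤ N] (Δ : Toric.Fan N) :
    IsAffine (Δ.toricVariety k) ↔ ∃ σ, Δ.IsGeneratedBy σ := by
  constructor
  · intro h
    obtain ⟨σ, hσ, hle⟩ := Δ.exists_forall_le_of_isAffine k
    refine ⟨σ, hσ, Set.Subset.antisymm (fun τ hτ => Or.inr ?_) ?_⟩
    -- Inclusion in `σ` becomes a face relation because `σ ⊓ τ = τ`.
    · have := (Δ.inter_isFace _ hσ _ hτ).1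
      rwa [inf_eq_right.2 (hle τ hτ)] at this
    · rintro τ (rfl | hτ)
      · exact hσ
      · exact Δ.face_mem σ hσ τ hτ
  · rintro ⟨σ, hσ⟩
    exact Δ.isAffine_of_isGeneratedBy k hσ
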